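/- Let $k$ be a field. A $k$-algebra $A$ is called just infinite if $\dim_k A=\infty$ and every nonzero two-sided ideal of $A$ has finite codimension over $k$; it is called stably just infinite if it is just infinite and, for every field extension $K/k$, the $K$-algebra $A\otimes_k K$ is just infinite over $K$. Let $k$ be algebraically closed and let $A$ be a commutative just infinite $k$-algebra. Then $A$ is an integral domain and, writing $Q(A)$ for its field of fractions: (1) $A$ is stably just infinite if and only if $Q(A)$ is a finitely generated field extension of $k$ of transcendence degree at most $1$. (2) If $A$ is affine (that is, finitely generated as a $k$-algebra), then $A$ is stably just infinite. -/

import Mathlib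

open scoped TensorProduct

universe u v w

/-- A `k`-algebra `A` (associative, unital, not necessarily commutative) is *just infinite*
(dimensional) if `dim_k A = ∞` and every nonzero two-sided ideal of `A` has finite codimension. -/
def IsJustInfinite (k : Type u) (A : Type v) [Field k] [Ring A] [Algebra k A] : Prop :=
  ¬ Module.Finite k A ∧
    ∀ I : Ideal A, I.IsTwoSided → I ≠ ⊥ → Module.Finite k (A ⧸ I)

/-- A `k`-algebra `A` is *stably just infinite* if it is just infinite and, for every field
extension `K / k` (with `K` in the universe `w`), the scalar extension of `A` to `K` is just
infinite over `K`. The scalar extension is written `K ⊗[k] A`, on which `K` acts through the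
left factor. -/
def IsStablyJustInfinite (k : Type u) (A : Type v) [Field k] [Ring A] [Algebra k A] : Prop :=
  IsJustInfinite k A ∧
    ∀ (K : Type w) [Field K] [Algebra k K], IsJustInfinite K (K ⊗[k] A)

open Polynomial

/-! A just infinite `A` over algebraically closed `k` contains some `x` transcendental over `k`, as
an algebraic domain would equal `k`. With `E = k(x)`, both conditions in (1) amount to finiteness of
`Q(A)` over `E`. If `Q(A)` is finite over `E`, then `A` has finite rank over `k[x]`, so `K ⊗ A` is a
domain of finite rank over `K[x]`, and a Krull–Akizuki argument makes its proper quotients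
finite-dimensional (`finite_quotient_of_rank_lt_aleph0`). Conversely, take `K = k(x)`: the map `K ⊗
A → Q(A)` kills the nonzero element `1 ⊗ x - x ⊗ 1`, so its image is finite over `K`, hence a field,
hence `Q(A)`. For affine `A`, `Q(A)` is a finitely generated `E`-algebra, and Zariski's lemma
applies. -/

theorem IsJustInfinite.isDomain {k : Type*} {A : Type*} [Field k] [CommRing A] [Algebra k A]
    (hA : IsJustInfinite k A) : IsDomain A := by
  have : Nontrivial A := by
    by_contra h
    rw [not_nontrivial_iff_subsingleton] at h
    exact hA.1 inferInstance
  have : NoZeroDivisors A := by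
    refine ⟨fun {x y} hxy => ?_⟩
    by_contra! h
    have h1 : Module.Finite k (A ⧸ Ideal.span {x}) :=
      hA.2 _ inferInstance (by simpa using h.1)
    -- If `x` is a zero divisor, `xA ≅ A / ann x` is finite-dimensional, as is `A / xA`; then so is
    -- `A`.
    let f : A →ₗ[A] A := LinearMap.toSpanSingleton A A x
    have hker : LinearMap.ker f ≠ ⊥ := by
      intro hb
      refine h.2 (LinearMap.ker_eq_bot'.mp hb y ?_)
      simp [f, mul_comm y x, hxy]
    have h2 : Module.Finite k (A ⧸ LinearMap.ker f) := hA.2 _ inferInstance hker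
    have h3 : Module.Finite k (LinearMap.range f) :=
      Module.Finite.equiv (f.quotKerEquivRange.restrictScalars k)
    have h4 : Module.Finite k (Ideal.span {x} : Ideal A) := by
      have : LinearMap.range f = Ideal.span {x} := LinearMap.range_toSpanSingleton x
      rw [← this]; exact h3
    let S : Submodule k A := (Ideal.span {x} : Ideal A).restrictScalars k
    have h5 : Module.Finite k S := h4
    have h6 : Module.Finite k (A ⧸ S) := h1
    exact hA.1 (Module.Finite.of_submodule_quotient S)
  exact NoZeroDivisors.to_isDomain A

/-! ### Tensor products of domains over an algebraically closed field -/

/-- Nullstellensatz: a nonzero element of an affine domain over an algebraically closed field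
does not vanish at some rational point. -/
theorem exists_algHom_apply_ne_zero {k R : Type*} [Field k] [IsAlgClosed k] [CommRing R]
    [IsDomain R] [Algebra k R] [Algebra.FiniteType k R] {r : R} (hr : r ≠ 0) :
    ∃ φ : R →ₐ[k] k, φ r ≠ 0 := by
  have : IsJacobsonRing R := isJacobsonRing_of_finiteType (A := k)
  have hj : (⊥ : Ideal R).jacobson = ⊥ :=
    (isJacobsonRing_iff.mp this) ⊥ Ideal.isPrime_bot.isRadical
  have : r ∉ (⊥ : Ideal R).jacobson := by rw [hj]; simpa using hr
  rw [Ideal.jacobson, Ideal.mem_sInf] at this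
  push Not at this
  obtain ⟨m, ⟨-, hm⟩, hrm⟩ := this
  let := Ideal.Quotient.field m
  have : Module.Finite k (R ⧸ m) := finite_of_finite_type_of_isJacobsonRing _ _
  let e : k ≃ₐ[k] R ⧸ m := AlgEquiv.ofBijective (Algebra.ofId k (R ⧸ m))
    (IsAlgClosed.algebraMap_bijective_of_isIntegral (k := k) (K := R ⧸ m))
  refine ⟨e.symm.toAlgHom.comp (Ideal.Quotient.mkₐ k m), ?_⟩
  simpa [Ideal.Quotient.eq_zero_iff_mem] using hrm

/-- Specialise `R` at a rational point where a chosen nonzero coordinate of each factor survives;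
both images in the domain `A` are then nonzero. -/
theorem noZeroDivisors_tensorProduct_of_finiteType {k R A : Type*} [Field k] [IsAlgClosed k]
    [CommRing R] [IsDomain R] [Algebra k R] [Algebra.FiniteType k R]
    [CommRing A] [IsDomain A] [Algebra k A] : NoZeroDivisors (R ⊗[k] A) := by
  refine ⟨fun {x y} hxy => ?_⟩
  by_contra! h
  let a := Module.Free.chooseBasis k A
  let b := Algebra.TensorProduct.basis R a
  have key : ∀ z : R ⊗[k] A, z ≠ 0 → ∃ i, b.repr z i ≠ 0 := by
    intro z hz
    by_contra! hb
    exact hz (b.repr.map_eq_zero_iff.mp (Finsupp.ext hb))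
  obtain ⟨i, hi⟩ := key x h.1
  obtain ⟨j, hj⟩ := key y h.2
  obtain ⟨φ, hφ⟩ := exists_algHom_apply_ne_zero (k := k) (mul_ne_zero hi hj)
  let ψ : R ⊗[k] A →ₐ[k] A :=
    Algebra.TensorProduct.lift ((Algebra.ofId k A).comp φ) (AlgHom.id k A)
      (fun _ _ => Commute.all _ _)
  have hψ : ∀ (z : R ⊗[k] A) i, a.repr (ψ z) i = φ (b.repr z i) := by
    intro z i
    induction z with
    | zero => simp
    | add z w hz hw => simp [hz, hw]
    | tmul r c =>
      simp [ψ, b, Algebra.TensorProduct.basis_repr_tmul, Algebra.ofId_apply, ← Algebra.smul_def]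
  rw [map_mul] at hφ
  have h1 : ψ x ≠ 0 := fun h0 => left_ne_zero_of_mul hφ (by rw [← hψ, h0]; simp)
  have h2 : ψ y ≠ 0 := fun h0 => right_ne_zero_of_mul hφ (by rw [← hψ, h0]; simp)
  exact mul_ne_zero h1 h2 (by rw [← map_mul, hxy, map_zero])

/-- Over an algebraically closed field, the tensor product of two domains is a domain. -/
theorem isDomain_tensorProduct_of_isAlgClosed {k K A : Type*} [Field k] [IsAlgClosed k]
    [CommRing K] [IsDomain K] [Algebra k K] [CommRing A] [IsDomain A] [Algebra k A] :
    IsDomain (K ⊗[k] A) := by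
  have : NoZeroDivisors (A ⊗[k] K) := by
    refine ⟨fun {x y} hxy => ?_⟩
    obtain ⟨C, hC, hx⟩ := exists_fg_and_mem_baseChange x
    obtain ⟨D, hD, hy⟩ := exists_fg_and_mem_baseChange y
    -- Two tensors involve only finitely many elements of `K`, so they come from a finitely
    -- generated subalgebra; flatness keeps the inclusion injective.
    let S := C ⊔ D
    have : Algebra.FiniteType k S := (Subalgebra.fg_iff_finiteType _).mp (hC.sup hD)
    have := noZeroDivisors_tensorProduct_of_finiteType (k := k) (R := S) (A := A)
    have hinj : Function.Injective (Algebra.TensorProduct.map (AlgHom.id A A) S.val) :=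
      Module.Flat.lTensor_preserves_injective_linearMap _ Subtype.val_injective
    have hmem : ∀ (T : Subalgebra k K), T ≤ S → ∀ z ∈ T.baseChange A,
        ∃ z', Algebra.TensorProduct.map (AlgHom.id A A) S.val z' = z := by
      rintro T hT _ ⟨z, rfl⟩
      refine ⟨Algebra.TensorProduct.map (AlgHom.id A A) (Subalgebra.inclusion hT) z, ?_⟩
      induction z with
      | zero => simp
      | add z w hz hw => simp only [map_add, hz, hw]
      | tmul r c => simp
    obtain ⟨x', rfl⟩ := hmem C le_sup_left x hx
    obtain ⟨y', rfl⟩ := hmem D le_sup_right y hy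
    have h0 : x' * y' = 0 := hinj (by rw [map_mul, hxy, map_zero])
    have : NoZeroDivisors (A ⊗[k] S) :=
      (Algebra.TensorProduct.comm k A S).toMulEquiv.noZeroDivisors _
    rcases mul_eq_zero.mp h0 with h | h <;> simp [h]
  have : NoZeroDivisors (K ⊗[k] A) :=
    (Algebra.TensorProduct.comm k K A).toMulEquiv.noZeroDivisors _
  exact NoZeroDivisors.to_isDomain _

/-! ### Modules of finite rank over a polynomial ring -/

/-- A Krull–Akizuki argument: a torsion-free `K[X]`-module of finite rank has finite-dimensional
quotients by multiples of a nonzero polynomial. -/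
theorem finite_of_rank_lt_aleph0_of_smul_eq_zero {K B V : Type*} [Field K] [AddCommGroup B]
    [Module K[X] B] [Module.IsTorsionFree K[X] B] (hrk : Module.rank K[X] B < Cardinal.aleph0)
    [AddCommGroup V] [Module K V] [Module K[X] V] [IsScalarTower K K[X] V]
    (π : B →ₗ[K[X]] V) (hπ : Function.Surjective π) {f : K[X]} (hf : f ≠ 0)
    (hfV : ∀ z : V, f • z = 0) : Module.Finite K V := by
  have hred : ∀ (p : K[X]) (z : V), p • z ∈
      Submodule.span K (Set.range fun j : Fin f.natDegree => (X ^ (j : ℕ) : K[X]) • z) := by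
    intro p z
    have h1 : p • z = (p % f) • z := by
      conv_lhs => rw [← EuclideanDomain.mod_add_div p f]
      rw [add_smul, mul_comm, mul_smul, hfV, smul_zero, add_zero]
    rw [h1]
    rcases eq_or_ne (p % f) 0 with h0 | h0
    · simp [h0]
    have hdeg : (p % f).natDegree < f.natDegree :=
      natDegree_lt_natDegree h0 (EuclideanDomain.mod_lt p hf)
    rw [(p % f).as_sum_range' _ hdeg, Finset.sum_smul]
    refine Submodule.sum_mem _ fun j hj => ?_
    rw [← C_mul_X_pow_eq_monomial, mul_smul, ← algebraMap_eq, algebraMap_smul]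
    exact Submodule.smul_mem _ _ (Submodule.subset_span ⟨⟨j, Finset.mem_range.mp hj⟩, rfl⟩)
  let r := Module.finrank K[X] B
  -- Independent vectors lift into a finitely generated torsion-free, hence free, `K[X]`-module of
  -- rank at most `r`; each basis element contributes at most `deg f` dimensions, since `f` kills
  -- `V`.
  have hbound : Module.rank K V ≤ (r * f.natDegree : ℕ) := by
    refine rank_le fun s hs => ?_
    choose g hg using hπ
    let M : Submodule K[X] B := Submodule.span K[X] (g '' s)
    have : Module.Finite K[X] M :=
      Module.Finite.span_of_finite _ (s.finite_toSet.image g)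
    have hM : Module.finrank K[X] M ≤ r := by
      refine Cardinal.toNat_le_toNat (Submodule.rank_le M) hrk
    let e := Module.finBasis K[X] M
    let T : Fin (Module.finrank K[X] M) × Fin f.natDegree → V :=
      fun q => (X ^ (q.2 : ℕ) : K[X]) • π (e q.1)
    have hT : ∀ m : M, π m ∈ Submodule.span K (Set.range T) := by
      intro m
      rw [← e.sum_repr m]
      simp only [AddSubmonoidClass.coe_finsetSum, map_sum, SetLike.val_smul, map_smul]
      refine Submodule.sum_mem _ fun i _ => ?_
      refine Submodule.span_mono ?_ (hred (e.repr m i) (π (e i)))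
      rintro _ ⟨j, rfl⟩
      exact ⟨(i, j), rfl⟩
    have hsT : (s : Set V) ⊆ Submodule.span K (Set.range T) := by
      intro z hz
      have := hT ⟨g z, Submodule.subset_span ⟨z, hz, rfl⟩⟩
      rwa [hg] at this
    have h1 : s.card ≤ Module.finrank K (Submodule.span K (Set.range T)) := by
      have : Module.Finite K (Submodule.span K (Set.range T)) :=
        Module.Finite.span_of_finite _ (Set.finite_range T)
      rw [← finrank_span_finset_eq_card hs]
      exact Submodule.finrank_mono (Submodule.span_le.mpr hsT)
    calc s.card ≤ _ := h1
      _ ≤ Fintype.card (Fin (Module.finrank K[X] M) × Fin f.natDegree) := finrank_range_le_card T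
      _ = Module.finrank K[X] M * f.natDegree := by simp
      _ ≤ r * f.natDegree := Nat.mul_le_mul_right _ hM
  exact Module.rank_lt_aleph0_iff.mp (hbound.trans_lt (Cardinal.natCast_lt_aleph0))

/-- A domain of finite rank over `K[X]` has only finite-dimensional proper quotients. -/
theorem finite_quotient_of_rank_lt_aleph0 {K B : Type*} [Field K] [CommRing B] [IsDomain B]
    [Algebra K B] [Algebra K[X] B] [IsScalarTower K K[X] B] [FaithfulSMul K[X] B]
    (hrk : Module.rank K[X] B < Cardinal.aleph0) {I : Ideal B} (hI : I ≠ ⊥) :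
    Module.Finite K (B ⧸ I) := by
  obtain ⟨b, hbI, hb⟩ := Submodule.exists_mem_ne_zero_of_ne_bot hI
  let J : Submodule K[X] B := I.restrictScalars K[X]
  -- Multiplication by `b` embeds `B` in `I`, so `B / I` has rank zero; the class of `1` is torsion,
  -- which puts a nonzero polynomial in `I`.
  have hJ : Module.rank K[X] B ≤ Module.rank K[X] J := by
    refine LinearMap.rank_le_of_injective
      ((LinearMap.mulRight K[X] b).codRestrict J fun c => I.mul_mem_left c hbI) ?_
    intro c d hcd
    exact mul_right_cancel₀ hb (congrArg Subtype.val hcd)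
  have h0 : Module.rank K[X] (B ⧸ J) = 0 := by
    have h1 := rank_quotient_add_rank_of_isDomain J
    have h2 : Module.rank K[X] (B ⧸ J) + Module.rank K[X] B ≤ 0 + Module.rank K[X] B := by
      rw [zero_add]
      exact (add_le_add_right hJ _).trans h1.le
    exact le_antisymm ((Cardinal.add_le_add_iff_of_lt_aleph0 hrk).mp h2) (zero_le)
  obtain ⟨f, hf, hf1⟩ := rank_eq_zero_iff.mp h0 (Submodule.Quotient.mk 1)
  have hfI : algebraMap K[X] B f ∈ I := by
    rw [← Submodule.Quotient.mk_smul, Submodule.Quotient.mk_eq_zero] at hf1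
    simpa [J, Algebra.smul_def] using hf1
  refine finite_of_rank_lt_aleph0_of_smul_eq_zero hrk
    ((Submodule.mkQ I).restrictScalars K[X]) (Submodule.mkQ_surjective I) hf fun z => ?_
  obtain ⟨c, rfl⟩ := Submodule.mkQ_surjective I z
  rw [← algebraMap_smul B f, ← map_smul, Submodule.mkQ_apply, Submodule.Quotient.mk_eq_zero]
  exact I.mul_mem_right c hfI

/-- A module of finite rank over a domain is torsion over a finitely generated submodule. -/
theorem exists_finset_forall_exists_smul_mem_span {R M : Type*} [CommRing R] [IsDomain R]
    [AddCommGroup M] [Module R M] (hrk : Module.rank R M < Cardinal.aleph0) :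
    ∃ t : Finset M, ∀ m : M, ∃ f : R, f ≠ 0 ∧ f • m ∈ Submodule.span R (t : Set M) := by
  obtain ⟨s, hs, hli⟩ := exists_set_linearIndependent_of_isDomain R M
  have hfin : s.Finite := Cardinal.lt_aleph0_iff_set_finite.mp (hs ▸ hrk)
  have hspan : Module.rank R (Submodule.span R s) = Module.rank R M := by
    rw [← hs]
    exact rank_span_set hli
  have h0 : Module.rank R (M ⧸ Submodule.span R s) = 0 := by
    have h1 := rank_quotient_add_rank_of_isDomain (Submodule.span R s)
    rw [hspan] at h1
    refine Cardinal.eq_of_add_eq_add_right ?_ hrk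
    rw [h1, zero_add]
  refine ⟨hfin.toFinset, fun m => ?_⟩
  obtain ⟨f, hf, hfm⟩ := rank_eq_zero_iff.mp h0 (Submodule.Quotient.mk m)
  refine ⟨f, hf, ?_⟩
  rwa [← Submodule.Quotient.mk_smul, Submodule.Quotient.mk_eq_zero,
    ← hfin.coe_toFinset] at hfm

theorem rank_lt_aleph0_of_forall_exists_smul_mem_span {R M : Type*} [CommRing R] [IsDomain R]
    [AddCommGroup M] [Module R M] (t : Set M) (ht : t.Finite)
    (h : ∀ m : M, ∃ f : R, f ≠ 0 ∧ f • m ∈ Submodule.span R t) :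
    Module.rank R M < Cardinal.aleph0 := by
  have h0 : Module.rank R (M ⧸ Submodule.span R t) = 0 := by
    refine rank_eq_zero_iff.mpr fun z => ?_
    obtain ⟨m, rfl⟩ := Submodule.Quotient.mk_surjective _ z
    obtain ⟨f, hf, hfm⟩ := h m
    exact ⟨f, hf, by rwa [← Submodule.Quotient.mk_smul, Submodule.Quotient.mk_eq_zero]⟩
  rw [← rank_quotient_add_rank_of_isDomain (Submodule.span R t), h0, zero_add]
  have : Module.Finite R (Submodule.span R t) := Module.Finite.span_of_finite _ ht
  exact Module.rank_lt_aleph0 R _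

/-- The powers of `x` are independent over `k`, and independence survives base change to `K`. -/
theorem aeval_one_tmul_injective {k K A : Type*} [Field k] [Field K] [Algebra k K] [CommRing A]
    [Algebra k A] {x : A} (hx : Transcendental k x) :
    Function.Injective (aeval (R := K) ((1 : K) ⊗ₜ[k] x)) := by
  have h1 : LinearIndependent k fun i : ℕ => x ^ i := by
    have := (Polynomial.basisMonomials k).linearIndependent.map' (aeval x).toLinearMap
      (LinearMap.ker_eq_bot.mpr (transcendental_iff_injective.mp hx))
    have heq : (fun i : ℕ => x ^ i) = (aeval x).toLinearMap ∘ Polynomial.basisMonomials k := by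
      ext i
      simp
    rwa [heq]
  have h2 := Module.Flat.linearIndependent_one_tmul (S := K) h1
  rw [injective_iff_map_eq_zero]
  intro p hp
  rw [aeval_eq_sum_range] at hp
  have h3 := linearIndependent_iff'.mp h2 (Finset.range (p.natDegree + 1)) p.coeff
    (by simpa [Algebra.TensorProduct.tmul_pow] using hp)
  ext i
  by_cases hi : i < p.natDegree + 1
  · exact h3 i (Finset.mem_range.mpr hi)
  · exact coeff_eq_zero_of_natDegree_lt (by omega)

/-- Scalar extensions of a domain of finite rank over `k[X]`, `k` algebraically closed, are just
infinite. -/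
theorem isJustInfinite_tensorProduct_of_rank_lt_aleph0 {k K A : Type*} [Field k] [IsAlgClosed k]
    [Field K] [Algebra k K] [CommRing A] [IsDomain A] [Algebra k A] [Algebra k[X] A]
    [IsScalarTower k k[X] A] [FaithfulSMul k[X] A]
    (hrk : Module.rank k[X] A < Cardinal.aleph0) : IsJustInfinite K (K ⊗[k] A) := by
  have hdom : IsDomain (K ⊗[k] A) := isDomain_tensorProduct_of_isAlgClosed
  let x : A := algebraMap k[X] A X
  have hx : ∀ f : k[X], aeval x f = algebraMap k[X] A f := fun f => by
    rw [aeval_algebraMap_apply, aeval_X_left_apply]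
  have htr : Transcendental k x := by
    rw [transcendental_iff_injective]
    intro f g hfg
    rw [hx, hx] at hfg
    exact FaithfulSMul.algebraMap_injective _ _ hfg
  have hinj := aeval_one_tmul_injective (K := K) htr
  let φ := aeval (R := K) ((1 : K) ⊗ₜ[k] x)
  let : Algebra K[X] (K ⊗[k] A) := φ.toRingHom.toAlgebra
  have : IsScalarTower K K[X] (K ⊗[k] A) := .of_algebraMap_eq fun c => (φ.commutes c).symm
  have : FaithfulSMul K[X] (K ⊗[k] A) := (faithfulSMul_iff_algebraMap_injective _ _).mpr hinj
  have hsmul : ∀ (f : k[X]) (a : A),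
      f.map (algebraMap k K) • ((1 : K) ⊗ₜ[k] a) = (1 : K) ⊗ₜ[k] (f • a) := by
    intro f a
    have : φ (f.map (algebraMap k K)) = (1 : K) ⊗ₜ[k] aeval x f := by
      rw [show φ (f.map (algebraMap k K)) = _ from aeval_map_algebraMap K _ f]
      exact aeval_algHom_apply (Algebra.TensorProduct.includeRight : A →ₐ[k] K ⊗[k] A) x f
    rw [Algebra.smul_def, Algebra.smul_def,
      show algebraMap K[X] (K ⊗[k] A) (f.map (algebraMap k K)) = _ from this, hx,
      Algebra.TensorProduct.tmul_mul_tmul, one_mul]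
  refine ⟨fun hfin => ?_, fun I _ hI => finite_quotient_of_rank_lt_aleph0 ?_ hI⟩
  · have : Module.Finite K K[X] :=
      Module.Finite.of_injective φ.toLinearMap hinj
    exact Polynomial.not_finite this
  · obtain ⟨t, ht⟩ := exists_finset_forall_exists_smul_mem_span hrk
    refine rank_lt_aleph0_of_forall_exists_smul_mem_span
      ((fun a => (1 : K) ⊗ₜ[k] a) '' (t : Set A)) (t.finite_toSet.image _) fun b => ?_
    induction b with
    | zero => exact ⟨1, one_ne_zero, by simp⟩
    | add y z hy hz =>
      obtain ⟨f, hf, hfy⟩ := hy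
      obtain ⟨g, hg, hgz⟩ := hz
      refine ⟨f * g, mul_ne_zero hf hg, ?_⟩
      rw [smul_add]
      refine Submodule.add_mem _ ?_ ?_
      · rw [mul_comm, mul_smul]; exact Submodule.smul_mem _ _ hfy
      · rw [mul_smul]; exact Submodule.smul_mem _ _ hgz
    | tmul c a =>
      obtain ⟨f, hf, hfa⟩ := ht a
      refine ⟨f.map (algebraMap k K),
        (Polynomial.map_ne_zero_iff (algebraMap k K).injective).mpr hf, ?_⟩
      have hc : c ⊗ₜ[k] a = c • ((1 : K) ⊗ₜ[k] a) := by simp [TensorProduct.smul_tmul']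
      rw [hc, smul_comm, hsmul]
      refine Submodule.smul_of_tower_mem _ c ?_
      generalize f • a = y at hfa ⊢
      induction hfa using Submodule.span_induction with
      | mem y hy => exact Submodule.subset_span ⟨y, hy, rfl⟩
      | zero => simp
      | add y z _ _ hy hz => rw [TensorProduct.tmul_add]; exact Submodule.add_mem _ hy hz
      | smul g y _ hy => rw [← hsmul]; exact Submodule.smul_mem _ _ hy

/-! ### Finiteness of the fraction field -/

theorem rank_lt_aleph0_of_finite_fractionField {R A E Q : Type*} [CommRing R] [IsDomain R]
    [CommRing A] [Algebra R A] [Field E] [Field Q] [Algebra R E] [IsFractionRing R E]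
    [Algebra A Q] [FaithfulSMul A Q] [Algebra E Q] [Algebra R Q]
    [IsScalarTower R E Q] [IsScalarTower R A Q] [Module.Finite E Q] :
    Module.rank R A < Cardinal.aleph0 := by
  have h1 := LinearMap.lift_rank_le_of_injective (IsScalarTower.toAlgHom R A Q).toLinearMap
    (FaithfulSMul.algebraMap_injective A Q)
  have h2 : Module.rank E Q = Module.rank R Q := IsLocalization.rank_eq E (nonZeroDivisors R) le_rfl
  rw [← h2] at h1
  exact Cardinal.lift_lt_aleph0.mp (h1.trans_lt (Cardinal.lift_lt_aleph0.mpr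
    (Module.rank_lt_aleph0 E Q)))

/-- The kernel of `K ⊗ A → Q` contains `1 ⊗ x - c ⊗ 1`, nonzero as `x` is transcendental. The image
is thus a domain finite over `K`, so a field; it contains `A`, so it is `Q`. -/
theorem finite_of_isJustInfinite_tensorProduct {k K A Q : Type*} [Field k] [Field K] [Algebra k K]
    [CommRing A] [Algebra k A] [Field Q] [Algebra A Q] [IsFractionRing A Q] [Algebra k Q]
    [Algebra K Q] [IsScalarTower k K Q] [IsScalarTower k A Q]
    (h : IsJustInfinite K (K ⊗[k] A)) {x : A} {c : K} (hxc : algebraMap A Q x = algebraMap K Q c)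
    (hx : Transcendental k x) : Module.Finite K Q := by
  let ψ : K ⊗[k] A →ₐ[K] Q :=
    Algebra.TensorProduct.lift (Algebra.ofId K Q) (IsScalarTower.toAlgHom k A Q)
      (fun _ _ => Commute.all _ _)
  have : Nontrivial A := (algebraMap A Q).domain_nontrivial
  have hker : RingHom.ker ψ ≠ ⊥ := by
    intro hbot
    have h0 : aeval ((1 : K) ⊗ₜ[k] x) (X - C c) = 0 := by
      rw [← Ideal.mem_bot, ← hbot, RingHom.mem_ker, ← aeval_algHom_apply]
      simp [ψ, hxc]
    exact X_sub_C_ne_zero c (aeval_one_tmul_injective hx (h0.trans (map_zero _).symm))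
  have h1 : Module.Finite K ((K ⊗[k] A) ⧸ RingHom.ker ψ) := h.2 _ inferInstance hker
  have h2 : Module.Finite K ψ.range :=
    Module.Finite.equiv (Ideal.quotientKerEquivRange ψ).toLinearEquiv
  have hA : ∀ a : A, algebraMap A Q a ∈ ψ.range := fun a => ⟨1 ⊗ₜ a, by simp [ψ]⟩
  have hfield : IsField ψ.range :=
    isField_of_isIntegral_of_isField' (Field.toIsField K)
  have htop : ψ.range = ⊤ := by
    refine top_le_iff.mp fun q _ => ?_
    obtain ⟨a, b, hb, rfl⟩ := IsFractionRing.div_surjective (A := A) q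
    have hb0 : algebraMap A Q b ≠ 0 := IsFractionRing.to_map_ne_zero_of_mem_nonZeroDivisors hb
    obtain ⟨d, hd⟩ := hfield.mul_inv_cancel (a := ⟨algebraMap A Q b, hA b⟩)
      (fun h => hb0 (congrArg Subtype.val h))
    have hd' : algebraMap A Q b * d = 1 := congrArg Subtype.val hd
    rw [div_eq_mul_inv, inv_eq_of_mul_eq_one_right hd']
    exact mul_mem (hA a) d.2
  rw [htop] at h2
  exact Module.Finite.equiv (Subalgebra.topEquiv (R := K) (A := Q)).toLinearEquiv

/-- Modulo any nonzero `b` the element `x` is integral over `k`, so `b` divides a nonzero polynomial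
in `x`. Inverting those polynomials therefore inverts `b`: generators of `A` generate `Q` as an
`E`-algebra, and Zariski's lemma gives finiteness. -/
theorem finite_fractionField_of_finiteType {k A E Q : Type*} [Field k] [CommRing A] [IsDomain A]
    [Algebra k A] [Algebra k[X] A] [IsScalarTower k k[X] A] [Field E] [Field Q] [Algebra k[X] E]
    [IsFractionRing k[X] E] [Algebra A Q] [IsFractionRing A Q] [Algebra E Q] [Algebra k[X] Q]
    [IsScalarTower k[X] E Q] [IsScalarTower k[X] A Q] (hA : IsJustInfinite k A)
    [Algebra.FiniteType k A] : Module.Finite E Q := by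
  let x : A := algebraMap k[X] A X
  have hmul : ∀ b : A, b ≠ 0 → ∃ p : k[X], p ≠ 0 ∧ ∃ c, algebraMap k[X] A p = b * c := by
    intro b hb
    have : Module.Finite k (A ⧸ Ideal.span {b}) := hA.2 _ inferInstance (by simpa using hb)
    obtain ⟨p, hp, hpx⟩ := Algebra.IsIntegral.isIntegral (R := k)
      (Ideal.Quotient.mk (Ideal.span {b}) x)
    refine ⟨p, hp.ne_zero, ?_⟩
    have h1 : Ideal.Quotient.mk (Ideal.span {b}) (algebraMap k[X] A p) = 0 := by
      rw [← hpx, ← aeval_def, ← Ideal.Quotient.mkₐ_eq_mk k, aeval_algHom_apply,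
        aeval_algebraMap_apply, aeval_X_left_apply]
    rw [Ideal.Quotient.eq_zero_iff_mem, Ideal.mem_span_singleton] at h1
    exact h1
  obtain ⟨s, hs⟩ := Algebra.FiniteType.out (R := k) (A := A)
  have : Algebra.FiniteType E Q := by
    classical
    refine ⟨s.image (algebraMap A Q), top_le_iff.mp fun q _ => ?_⟩
    let S := Algebra.adjoin E ((s.image (algebraMap A Q) : Finset Q) : Set Q)
    have hmem : ∀ a : A, algebraMap A Q a ∈ S := by
      intro a
      have ha : a ∈ Algebra.adjoin k (s : Set A) := by rw [hs]; trivial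
      induction ha using Algebra.adjoin_induction with
      | mem y hy => exact Algebra.subset_adjoin (Finset.mem_coe.mpr (Finset.mem_image_of_mem _ hy))
      | algebraMap r =>
        rw [IsScalarTower.algebraMap_apply k k[X] A, ← IsScalarTower.algebraMap_apply k[X] A Q,
          IsScalarTower.algebraMap_apply k[X] E Q]
        exact S.algebraMap_mem _
      | add y z _ _ hy hz => rw [map_add]; exact add_mem hy hz
      | mul y z _ _ hy hz => rw [map_mul]; exact mul_mem hy hz
    obtain ⟨a, b, hb, rfl⟩ := IsFractionRing.div_surjective (A := A) q
    obtain ⟨p, hp, c, hc⟩ := hmul b (nonZeroDivisors.ne_zero hb)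
    have hp0 : algebraMap k[X] E p ≠ 0 := by
      simpa using hp
    have hbc : algebraMap A Q b * algebraMap A Q c = algebraMap E Q (algebraMap k[X] E p) := by
      rw [← map_mul, ← hc, ← IsScalarTower.algebraMap_apply, ← IsScalarTower.algebraMap_apply]
    have hinv : (algebraMap A Q b)⁻¹ =
        algebraMap A Q c * algebraMap E Q (algebraMap k[X] E p)⁻¹ := by
      refine inv_eq_of_mul_eq_one_right ?_
      rw [← mul_assoc, hbc, ← map_mul, mul_inv_cancel₀ hp0, map_one]
    rw [div_eq_mul_inv, hinv]
    exact mul_mem (hmem a) (mul_mem (hmem c) (S.algebraMap_mem _))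
  exact finite_of_finite_type_of_isJacobsonRing E Q

theorem trdeg_of_isFractionRing_polynomial {k : Type u} {E : Type v} [Field k] [Field E]
    [Algebra k[X] E] [IsFractionRing k[X] E] [Algebra k E] [IsScalarTower k k[X] E] :
    Algebra.trdeg k E = 1 := by
  have : Algebra.IsAlgebraic k[X] E := IsLocalization.isAlgebraic E (nonZeroDivisors k[X])
  have h := lift_trdeg_add_eq k k[X] E
  rw [Polynomial.trdeg_of_isDomain, trdeg_eq_zero (R := k[X])] at h
  simpa using h.symm

/-- Transcendence degree adds along `k ⊂ E ⊂ Q` and `E` has degree 1, so the bound forces `Q` to be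
algebraic over `E`; essential finite type makes it finite. -/
theorem finite_iff_fg_and_trdeg_le_one {k : Type u} {E : Type v} {Q : Type w} [Field k] [Field E]
    [Field Q] [Algebra k[X] E] [IsFractionRing k[X] E] [Algebra k E] [IsScalarTower k k[X] E]
    [Algebra E Q] [Algebra k Q] [IsScalarTower k E Q] :
    Module.Finite E Q ↔ (⊤ : IntermediateField k Q).FG ∧ Algebra.trdeg k Q ≤ 1 := by
  have h := lift_trdeg_add_eq k E Q
  rw [trdeg_of_isFractionRing_polynomial, Cardinal.lift_one] at h
  have hE : Algebra.EssFiniteType k E :=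
    have : Algebra.EssFiniteType k[X] E := .of_isLocalization _ (nonZeroDivisors k[X])
    .comp k k[X] E
  rw [IntermediateField.fg_top_iff]
  refine ⟨fun hfin => ⟨.comp k E Q, ?_⟩, fun ⟨hfg, htr⟩ => ?_⟩
  · rw [trdeg_eq_zero] at h
    have : Algebra.trdeg k Q = 1 := by simpa using h.symm
    exact this.le
  · have : Algebra.EssFiniteType E Q := .of_comp k E Q
    have h0 : Algebra.trdeg E Q = 0 := by
      have h1 : Cardinal.lift.{v} (Algebra.trdeg E Q) + 1 ≤ 0 + 1 := by
        rw [add_comm, h]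
        simpa using htr
      simpa using Cardinal.add_one_le_add_one_iff.mp h1
    have : Algebra.IsAlgebraic E Q := trdeg_eq_zero_iff.mp h0
    exact Algebra.finite_of_essFiniteType_of_isAlgebraic

theorem IsJustInfinite.exists_transcendental {k A : Type*} [Field k] [IsAlgClosed k] [CommRing A]
    [IsDomain A] [Algebra k A] (hA : IsJustInfinite k A) : ∃ x : A, Transcendental k x := by
  by_contra! h
  have : Algebra.IsAlgebraic k A := ⟨fun x => not_not.mp (h x)⟩
  refine hA.1 (Module.Finite.of_surjective (Algebra.linearMap k A) ?_)
  exact (IsAlgClosed.algebraMap_bijective_of_isIntegral (k := k) (K := A)).2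

/-- Over an algebraically closed field, a commutative just infinite algebra is stably just infinite
if and only if its fraction field is finite over the field of rational functions in one of its
transcendental elements. -/
theorem isStablyJustInfinite_iff_finite {k : Type u} {A : Type v} [Field k] [IsAlgClosed k]
    [CommRing A] [IsDomain A] [Algebra k A] [Algebra k[X] A] [IsScalarTower k k[X] A]
    [FaithfulSMul k[X] A] {E Q : Type*} [Field E] [Field Q] [Algebra k[X] E]
    [IsFractionRing k[X] E] [Algebra A Q] [IsFractionRing A Q] [Algebra E Q] [Algebra k[X] Q]
    [IsScalarTower k[X] E Q] [IsScalarTower k[X] A Q] (hA : IsJustInfinite k A) :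
    IsStablyJustInfinite.{u, v, max u v w} k A ↔ Module.Finite E Q := by
  refine ⟨fun h => ?_, fun h => ⟨hA, fun K _ _ =>
    isJustInfinite_tensorProduct_of_rank_lt_aleph0
      (rank_lt_aleph0_of_finite_fractionField (E := E) (Q := Q))⟩⟩
  let F := FractionRing k[X]
  let e : E ≃ₐ[k[X]] F := (FractionRing.algEquiv k[X] E).symm
  -- The test field `k(x)` must live in the universe over which stability quantifies.
  let K := ULift.{max u v w} F
  let ρ : K →+* Q :=
    (algebraMap E Q).comp (e.symm.toRingHom.comp (ULift.ringEquiv (R := F)).toRingHom)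
  let : Algebra K Q := ρ.toAlgebra
  let : Algebra k Q := ((algebraMap A Q).comp (algebraMap k A)).toAlgebra
  have : IsScalarTower k A Q := .of_algebraMap_eq fun _ => rfl
  have hρ : ∀ p : k[X],
      ρ (ULift.up (algebraMap k[X] F p)) = algebraMap A Q (algebraMap k[X] A p) := by
    intro p
    have : ρ (ULift.up (algebraMap k[X] F p)) =
      algebraMap E Q (e.symm (algebraMap k[X] F p)) := rfl
    rw [this, e.symm.commutes, ← IsScalarTower.algebraMap_apply, ← IsScalarTower.algebraMap_apply]
  have : IsScalarTower k K Q := .of_algebraMap_eq fun c => by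
    rw [IsScalarTower.algebraMap_apply k A Q, IsScalarTower.algebraMap_apply k k[X] A, ← hρ]
    rfl
  have hfin : Module.Finite K Q := by
    refine finite_of_isJustInfinite_tensorProduct (h.2 K) (hρ X).symm ?_
    rw [transcendental_iff_injective]
    intro f g hfg
    simp only [aeval_algebraMap_apply, aeval_X_left_apply] at hfg
    exact FaithfulSMul.algebraMap_injective _ _ hfg
  let σ : K →+* E := e.symm.toRingHom.comp (ULift.ringEquiv (R := F)).toRingHom
  let : Algebra K E := σ.toAlgebra
  have : IsScalarTower K E Q := .of_algebraMap_eq fun _ => rfl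
  exact Module.Finite.of_restrictScalars_finite K E Q

attribute [local instance] FractionRing.liftAlgebra in
theorem mainTheorem9 (k : Type u) (A : Type v) [Field k] [IsAlgClosed k]
    [CommRing A] [Algebra k A] (hA : IsJustInfinite k A) :
    ∃ _ : IsDomain A,
      (IsStablyJustInfinite.{u, v, max u v w} k A ↔
        (⊤ : IntermediateField k (FractionRing A)).FG ∧
          Algebra.trdeg k (FractionRing A) ≤ 1) ∧
      (Algebra.FiniteType k A → IsStablyJustInfinite.{u, v, max u v w} k A) := by
  have hdom := hA.isDomain
  obtain ⟨x, hx⟩ := hA.exists_transcendental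
  let : Algebra k[X] A := (aeval x).toRingHom.toAlgebra
  have : IsScalarTower k k[X] A := .of_algebraMap_eq fun c => ((aeval x).commutes c).symm
  have : FaithfulSMul k[X] A :=
    (faithfulSMul_iff_algebraMap_injective _ _).mpr (transcendental_iff_injective.mp hx)
  have hstab := isStablyJustInfinite_iff_finite.{u, v, w} (E := FractionRing k[X])
    (Q := FractionRing A) hA
  exact ⟨hdom, hstab.trans finite_iff_fg_and_trdeg_le_one,
    fun _ => hstab.mpr (finite_fractionField_of_finiteType hA)⟩
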